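/- Let $q$ be a prime power and let $k,m\ge 1$ be integers. A code is an $\mathbb{F}_q$-linear subspace $\mathcal{C}\subseteq \mathrm{Mat}(k\times m,\mathbb{F}_q)$ of the space of $k\times m$ matrices over the finite field $\mathbb{F}_q$. Its maximum rank is $\mathrm{maxrk}(\mathcal{C}) := \max\{\mathrm{rk}(M) : M\in\mathcal{C}\}$, and its dual is $\mathcal{C}^\perp := \{N\in \mathrm{Mat}(k\times m,\mathbb{F}_q) : \mathrm{Tr}(MN^t)=0 \text{ for all } M\in\mathcal{C}\}$. A code $\mathcal{C}$ is called an optimal anticode if $\dim_{\mathbb{F}_q}(\mathcal{C}) = \max\{k,m\}\cdot \mathrm{maxrk}(\mathcal{C})$ (every code satisfies this with $\le$ in place of $=$). Then every code $\mathcal{C}\subseteq \mathrm{Mat}(k\times m,\mathbb{F}_q)$ satisfies $$\mathrm{maxrk}(\mathcal{C}) \ge \min\{k,m\}-\mathrm{maxrk}(\mathcal{C}^\perp),$$ and equality holds if and only if $\mathcal{C}$ is an optimal anticode. -/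

import Mathlib

namespace RankMetric

/-- The trace product `⟨M, N⟩ = Tr(M Nᵗ)` of two `k × m` matrices. -/
def traceProduct {F : Type*} [Field F] {k m : ℕ} (M N : Matrix (Fin k) (Fin m) F) : F :=
  Matrix.trace (M * N.transpose)

/-- A (Delsarte rank-metric) code of size `k × m` over `F` is an `F`-linear subspace of the space
of `k × m` matrices over `F`. -/
abbrev Code (F : Type*) [Field F] (k m : ℕ) : Type _ :=
  Submodule F (Matrix (Fin k) (Fin m) F)

/-- The maximum rank of a code: the largest rank of one of its elements. -/
noncomputable def maxrk {F : Type*} [Field F] {k m : ℕ} (C : Code F k m) : ℕ :=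
  sSup {r : ℕ | ∃ M ∈ C, M.rank = r}

/-- The supremum in the definition of the maximum rank is a maximum. -/
theorem isGreatest_maxrk {F : Type*} [Field F] {k m : ℕ} (C : Code F k m) :
    IsGreatest {r : ℕ | ∃ M ∈ C, M.rank = r} (maxrk C) := by
  have hb : BddAbove {r : ℕ | ∃ M ∈ C, M.rank = r} := by
    refine ⟨k, ?_⟩
    rintro r ⟨M, -, rfl⟩
    simpa using M.rank_le_card_height
  have hne : {r : ℕ | ∃ M ∈ C, M.rank = r}.Nonempty := ⟨_, 0, C.zero_mem, rfl⟩
  exact ⟨Nat.sSup_mem hne hb, fun r hr => le_csSup hb hr⟩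

/-- The dual code: all matrices `N` with `⟨M, N⟩ = 0` for every `M` in the code. -/
def dual {F : Type*} [Field F] {k m : ℕ} (C : Code F k m) : Code F k m where
  carrier := {N | ∀ M ∈ C, traceProduct M N = 0}
  zero_mem' := by
    intro M _
    simp [traceProduct]
  add_mem' := by
    intro A B hA hB M hM
    have h1 := hA M hM
    have h2 := hB M hM
    simp only [traceProduct] at h1 h2 ⊢
    rw [Matrix.transpose_add, Matrix.mul_add, Matrix.trace_add, h1, h2, add_zero]
  smul_mem' := by
    intro c A hA M hM
    have h1 := hA M hM
    simp only [traceProduct] at h1 ⊢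
    rw [Matrix.transpose_smul, Matrix.mul_smul, Matrix.trace_smul, h1, smul_zero]

/-- An optimal anticode is a code attaining the upper bound `dim C ≤ max {k, m} · maxrk C`. -/
def IsOptimalAnticode {F : Type*} [Field F] {k m : ℕ} (C : Code F k m) : Prop :=
  Module.finrank F C = max k m * maxrk C

end RankMetric

/-! Transposition reduces to `k ≤ m`. The anticode bound `dim C ≤ m * maxrk C` holds because an MRD
code with minimum rank `maxrk C + 1` meets `C` trivially. Adding it for `C` and `dual C`, whose
dimensions sum to `k * m`, gives the inequality; equality there forces both bounds to be tight.
Conversely, let `dim C = m * r` with `r = maxrk C`, and let `N ∈ dual C` have rank above `k - r`.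
The key point is that `N` lies in some MRD code `D` of dimension `m * r` (`exists_mrd_code_mem`).
Nonzero elements of `dual D` have rank above `r`, so `C` and `dual D` are complementary. As `N` is
orthogonal to both, `N = 0`, a contradiction. -/

namespace RankMetric
open Module Polynomial

/-! ### Linearized polynomials and their kernels -/

section Gabidulin

variable (F L : Type*) [Field F] [Fintype F] [Field L] [Algebra F L]

/-- The `F`-linear map `x ↦ ∑ i < n, a i * x ^ (q ^ i)` attached to a coefficient vector `a`. -/
noncomputable def linearizedMap (n : ℕ) : (Fin n → L) →ₗ[L] (L →ₗ[F] L) :=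
  Fintype.linearCombination L fun i : Fin n =>
    (FiniteField.frobeniusAlgHom F L ^ (i : ℕ)).toLinearMap

theorem linearizedMap_apply (n : ℕ) (a : Fin n → L) (x : L) :
    linearizedMap F L n a x = ∑ i, a i * x ^ (Fintype.card F ^ (i : ℕ)) := by
  simp [linearizedMap, Fintype.linearCombination_apply, LinearMap.sum_apply, AlgHom.coe_pow,
    FiniteField.coe_frobeniusAlgHom, pow_iterate]

theorem range_linearizedMap_mono {n t : ℕ} (h : n ≤ t) :
    LinearMap.range (linearizedMap F L n) ≤ LinearMap.range (linearizedMap F L t) := by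
  simp only [linearizedMap, Fintype.range_linearCombination]
  apply Submodule.span_mono
  rintro _ ⟨i, rfl⟩
  exact ⟨Fin.castLE h i, rfl⟩

/-- The kernel consists of roots of a nonzero polynomial of degree at most `q ^ (n - 1)`, where `q =
|F|`. -/
theorem finrank_ker_linearizedMap_lt [Finite L] {n : ℕ} {a : Fin n → L} (ha : a ≠ 0) :
    finrank F (LinearMap.ker (linearizedMap F L n a)) < n := by
  classical
  obtain ⟨i₀, hi₀⟩ : ∃ i, a i ≠ 0 := by
    by_contra! h
    exact ha (funext h)
  have hn : 0 < n := i₀.pos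
  have hq : 1 < Fintype.card F := Fintype.one_lt_card
  let P : L[X] := ∑ i : Fin n, C (a i) * X ^ (Fintype.card F ^ (i : ℕ))
  have hcoeff : P.coeff (Fintype.card F ^ (i₀ : ℕ)) = a i₀ := by
    simp only [P, finsetSum_coeff, coeff_C_mul, coeff_X_pow]
    rw [Finset.sum_eq_single i₀]
    · simp
    · intro j _ hj
      have : ¬ Fintype.card F ^ (i₀ : ℕ) = Fintype.card F ^ (j : ℕ) := fun h =>
        hj (Fin.ext (Nat.pow_right_injective hq h).symm)
      simp [this]
    · simp
  have hP : P ≠ 0 := by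
    intro h
    rw [h, coeff_zero] at hcoeff
    exact hi₀ hcoeff.symm
  have hdeg : P.natDegree ≤ Fintype.card F ^ (n - 1) := by
    apply natDegree_sum_le_of_forall_le
    intro i _
    refine (natDegree_C_mul_X_pow_le _ _).trans (Nat.pow_le_pow_right hq.le ?_)
    omega
  have hsub : (LinearMap.ker (linearizedMap F L n a) : Set L) ⊆ P.roots.toFinset := by
    intro x hx
    have hx' : linearizedMap F L n a x = 0 := hx
    rw [linearizedMap_apply] at hx'
    simp [hP, P, eval_finsetSum, hx']
  have hcard : Nat.card (LinearMap.ker (linearizedMap F L n a)) ≤ Fintype.card F ^ (n - 1) := by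
    calc Nat.card (LinearMap.ker (linearizedMap F L n a))
        ≤ P.roots.toFinset.card := by
          have := Set.ncard_le_ncard hsub (Finset.finite_toSet _)
          rwa [Set.ncard_coe_finset] at this
      _ ≤ P.roots.card := Multiset.toFinset_card_le _
      _ ≤ P.natDegree := P.card_roots'
      _ ≤ _ := hdeg
  rw [Module.natCard_eq_pow_finrank (K := F), Nat.card_eq_fintype_card] at hcard
  have := (Nat.pow_le_pow_iff_right hq).1 hcard
  omega

/-- Vanishing on a basis of `W` imposes `d` conditions on `d + 1` coefficients, so a nonzero
solution exists; the root bound keeps its kernel from exceeding `W`. -/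
theorem exists_ker_linearizedMap_eq [Finite L] (W : Submodule F L) {t : ℕ}
    (hW : finrank F W < t) :
    ∃ a : Fin t → L, LinearMap.ker (linearizedMap F L t a) = W := by
  set d := finrank F W with hd
  let b := finBasis F W
  let Φ : (Fin (d + 1) → L) →ₗ[L] (Fin d → L) :=
    LinearMap.pi fun j => (LinearMap.applyₗ' L (b j : L)).comp (linearizedMap F L (d + 1))
  have hΦ : LinearMap.ker Φ ≠ ⊥ := Φ.ker_ne_bot_of_finrank_lt (by simp)
  obtain ⟨a, haΦ, ha⟩ := Submodule.exists_mem_ne_zero_of_ne_bot hΦ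
  have hle : W ≤ LinearMap.ker (linearizedMap F L (d + 1) a) := by
    intro x hx
    have h0 : (linearizedMap F L (d + 1) a).comp W.subtype = 0 := by
      apply b.ext
      intro j
      exact congrFun haΦ j
    exact LinearMap.congr_fun h0 ⟨x, hx⟩
  have heq := Submodule.eq_of_le_of_finrank_le hle
    (Nat.lt_succ_iff.1 (finrank_ker_linearizedMap_lt F L ha))
  obtain ⟨a', ha'⟩ := range_linearizedMap_mono F L (Nat.succ_le_of_lt hW) ⟨a, rfl⟩
  exact ⟨a', by rw [ha', ← heq]⟩

end Gabidulin

/-! ### Maps with equal kernels -/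

section LinearAlgebra

variable {K V W : Type*} [Field K] [AddCommGroup V] [Module K V] [AddCommGroup W] [Module K W]

theorem exists_linearEquiv_comp_eq {W' : Type*} [AddCommGroup W'] [Module K W']
    [FiniteDimensional K W] (e₀ : W ≃ₗ[K] W') (f : V →ₗ[K] W) (g : V →ₗ[K] W')
    (h : LinearMap.ker f = LinearMap.ker g) : ∃ e : W ≃ₗ[K] W', e.toLinearMap ∘ₗ f = g := by
  let g' : V →ₗ[K] W := e₀.symm.toLinearMap ∘ₗ g
  have hg' : LinearMap.ker f = LinearMap.ker g' := by
    rw [h, LinearEquiv.ker_comp]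
  let u : LinearMap.range f ≃ₗ[K] LinearMap.range g' :=
    f.quotKerEquivRange.symm.trans
      ((Submodule.quotEquivOfEq _ _ hg').trans g'.quotKerEquivRange)
  have hu : ∀ x, (u ⟨f x, x, rfl⟩ : W) = g' x := by
    intro x
    have : f.quotKerEquivRange.symm ⟨f x, x, rfl⟩ = Submodule.Quotient.mk x := by
      rw [LinearEquiv.symm_apply_eq]; rfl
    simp only [u, LinearEquiv.trans_apply, this, Submodule.quotEquivOfEq_mk]
    rfl
  obtain ⟨e, he⟩ := Submodule.exists_linearEquiv_restrict_eq u
  refine ⟨e.trans e₀, LinearMap.ext fun x => ?_⟩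
  have := he ⟨f x, x, rfl⟩
  simp only [LinearMap.comp_apply, LinearEquiv.coe_coe, LinearEquiv.trans_apply]
  rw [show e (f x) = g' x from ?_]
  · simp [g']
  · rw [← hu]; exact this.symm

end LinearAlgebra

theorem exists_injective_linearMap_of_le_finrank {K V : Type*} [Field K] [AddCommGroup V]
    [Module K V] [FiniteDimensional K V] {n : ℕ} (h : n ≤ finrank K V) :
    ∃ g : (Fin n → K) →ₗ[K] V, Function.Injective g :=
  ⟨(finBasis K V).equivFun.symm.toLinearMap ∘ₗ
      Function.ExtendByZero.linearMap K (Fin.castLE h),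
    (finBasis K V).equivFun.symm.injective.comp
      (Function.extend_injective (Fin.castLE_injective h) 0)⟩

/-! ### MRD codes through a prescribed matrix -/

section MRD

variable {F : Type*} [Field F]

/-- A `k × m` matrix seen as a linear map from `F ^ k` to `F ^ m`. -/
noncomputable def rowLin (F : Type*) [Field F] (k m : ℕ) :
    Matrix (Fin k) (Fin m) F ≃ₗ[F] ((Fin k → F) →ₗ[F] (Fin m → F)) :=
  (Matrix.transposeLinearEquiv (Fin k) (Fin m) F F).trans Matrix.toLin'

theorem rank_add_finrank_ker_rowLin {k m : ℕ} (M : Matrix (Fin k) (Fin m) F) :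
    M.rank + finrank F (LinearMap.ker (rowLin F k m M)) = k := by
  have h := LinearMap.finrank_range_add_finrank_ker (rowLin F k m M)
  rw [finrank_fin_fun] at h
  rw [← M.rank_transpose]
  exact h

/-- Over a finite field, every matrix of rank at least `k - t + 1` lies in a linear code of
dimension `m * t` all of whose nonzero elements have rank at least `k - t + 1`. -/
theorem exists_mrd_code_mem [Finite F] {k m t : ℕ} (hm : 0 < m) (hkm : k ≤ m) (htk : t ≤ k)
    (N : Matrix (Fin k) (Fin m) F) (hN : k < N.rank + t) :
    ∃ D : Code F k m, N ∈ D ∧ finrank F D = m * t ∧ ∀ M ∈ D, M ≠ 0 → k < M.rank + t := by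
  have := Fintype.ofFinite F
  obtain ⟨p, hp⟩ := CharP.exists F
  have : Fact p.Prime := ⟨CharP.char_is_prime F p⟩
  have : NeZero m := ⟨hm.ne'⟩
  let L := FiniteField.Extension F p m
  have hL : finrank F L = m := FiniteField.finrank_extension F p m
  let e₀ : (Fin m → F) ≃ₗ[F] L := LinearEquiv.ofFinrankEq _ _ (by simp [hL])
  obtain ⟨g, hg⟩ := exists_injective_linearMap_of_le_finrank (hkm.trans hL.ge)
  have hKN := rank_add_finrank_ker_rowLin N
  set K := LinearMap.ker (rowLin F k m N)
  have hKg : finrank F (K.map g) = finrank F K :=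
    (Submodule.equivMapOfInjective g hg K).finrank_eq.symm
  -- The rank hypothesis on `N` says exactly that its kernel has dimension below `t`.
  obtain ⟨a, ha⟩ := exists_ker_linearizedMap_eq F L (K.map g) (t := t) (by omega)
  have hker : K = LinearMap.ker ((linearizedMap F L t a).comp g) := by
    rw [LinearMap.ker_comp, ha, Submodule.comap_map_eq_of_injective hg]
  -- Identifying `L` with `F ^ m` through `e` rather than `e₀` makes the Gabidulin code contain `N`
  -- itself.
  obtain ⟨e, he⟩ := exists_linearEquiv_comp_eq e₀ _ _ hker
  let Ψ : (Fin t → L) →ₗ[F] Matrix (Fin k) (Fin m) F :=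
    (rowLin F k m).symm.toLinearMap ∘ₗ (LinearEquiv.congrRight e.symm).toLinearMap ∘ₗ
      LinearMap.lcomp F L g ∘ₗ (linearizedMap F L t).restrictScalars F
  have hΨ : ∀ c, rowLin F k m (Ψ c) =
      e.symm.toLinearMap ∘ₗ (linearizedMap F L t c).comp g := by
    intro c
    simp only [Ψ, LinearMap.comp_apply, LinearEquiv.coe_coe, LinearEquiv.apply_symm_apply]
    rfl
  have hrank : ∀ c, c ≠ 0 → k < (Ψ c).rank + t := by
    intro c hc
    have h1 := rank_add_finrank_ker_rowLin (Ψ c)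
    have h2 := finrank_ker_linearizedMap_lt F L hc
    rw [hΨ, LinearEquiv.ker_comp, LinearMap.ker_comp] at h1
    have h3 : finrank F ((LinearMap.ker (linearizedMap F L t c)).comap g) ≤
        finrank F (LinearMap.ker (linearizedMap F L t c)) := by
      rw [(Submodule.equivMapOfInjective g hg _).finrank_eq]
      exact Submodule.finrank_mono (Submodule.map_comap_le _ _)
    omega
  have hinj : Function.Injective Ψ := by
    rw [← LinearMap.ker_eq_bot, LinearMap.ker_eq_bot']
    intro c hc
    by_contra h
    have := hrank c h
    rw [hc, Matrix.rank_zero] at this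
    omega
  refine ⟨LinearMap.range Ψ, ⟨a, ?_⟩, ?_, ?_⟩
  · apply (rowLin F k m).injective
    rw [hΨ, ← he]
    ext
    simp
  · rw [LinearMap.finrank_range_of_inj hinj, finrank_pi_fintype]
    simp [hL, mul_comm]
  · rintro _ ⟨c, rfl⟩ hc
    exact hrank c fun h => hc (by rw [h, map_zero])

end MRD

/-! ### Trace duality and transposition -/

section Duality

variable {F : Type*} [Field F] {k m : ℕ}

theorem traceProduct_comm (M N : Matrix (Fin k) (Fin m) F) :
    traceProduct M N = traceProduct N M := by
  rw [traceProduct, ← Matrix.trace_transpose, Matrix.transpose_mul, Matrix.transpose_transpose,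
    traceProduct]

theorem traceProduct_transpose (M N : Matrix (Fin k) (Fin m) F) :
    traceProduct M.transpose N.transpose = traceProduct M N := by
  rw [traceProduct_comm M N, traceProduct, traceProduct, Matrix.transpose_transpose,
    Matrix.trace_mul_comm]

/-- The trace product as a bilinear form. -/
noncomputable def traceBilin (F : Type*) [Field F] (k m : ℕ) :
    LinearMap.BilinForm F (Matrix (Fin k) (Fin m) F) :=
  LinearMap.mk₂ F traceProduct
    (fun _ _ _ => by simp [traceProduct, Matrix.add_mul])
    (fun _ _ _ => by simp [traceProduct])
    (fun _ _ _ => by simp [traceProduct, Matrix.mul_add])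
    (fun _ _ _ => by simp [traceProduct])

theorem eq_zero_of_forall_traceProduct_eq_zero {N : Matrix (Fin k) (Fin m) F}
    (h : ∀ M, traceProduct M N = 0) : N = 0 := by
  rw [← Matrix.transpose_eq_zero, Matrix.ext_iff_trace_mul_left]
  intro M
  simpa [traceProduct] using h M

theorem traceBilin_nondegenerate : (traceBilin F k m).Nondegenerate := by
  refine ⟨fun N h => ?_, fun N h => eq_zero_of_forall_traceProduct_eq_zero h⟩
  exact eq_zero_of_forall_traceProduct_eq_zero fun M => (traceProduct_comm M N).trans (h M)

theorem finrank_add_finrank_dual (C : Code F k m) :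
    finrank F C + finrank F (dual C) = k * m := by
  have h := LinearMap.BilinForm.finrank_orthogonal (traceBilin_nondegenerate (F := F)) C
  have h' : (traceBilin F k m).orthogonal C = dual C := rfl
  have hle := C.finrank_le
  rw [h'] at h
  rw [finrank_matrix] at h hle
  simp only [Fintype.card_fin, finrank_self, mul_one] at h hle
  omega

theorem sup_eq_top_of_disjoint {C D : Code F k m} (h : Disjoint C D)
    (hd : k * m ≤ finrank F C + finrank F D) : C ⊔ D = ⊤ := by
  refine Submodule.eq_top_of_disjoint C D ?_ h
  simpa [finrank_matrix] using hd

theorem eq_zero_of_mem_dual_of_mem_dual {C D : Code F k m} (h : C ⊔ D = ⊤)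
    {N : Matrix (Fin k) (Fin m) F} (hC : N ∈ dual C) (hD : N ∈ dual D) : N = 0 := by
  refine eq_zero_of_forall_traceProduct_eq_zero fun M => ?_
  obtain ⟨A, hA, B, hB, rfl⟩ := Submodule.mem_sup.1 (h ▸ Submodule.mem_top : M ∈ C ⊔ D)
  rw [traceProduct, Matrix.add_mul, Matrix.trace_add]
  exact (congrArg₂ (· + ·) (hC A hA) (hD B hB)).trans (add_zero 0)

theorem rank_le_maxrk {C : Code F k m} {M : Matrix (Fin k) (Fin m) F} (h : M ∈ C) :
    M.rank ≤ maxrk C :=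
  (isGreatest_maxrk C).2 ⟨M, h, rfl⟩

theorem maxrk_le {C : Code F k m} {r : ℕ} (h : ∀ M ∈ C, M.rank ≤ r) : maxrk C ≤ r := by
  obtain ⟨M, hM, hr⟩ := (isGreatest_maxrk C).1
  exact hr ▸ h M hM

/-- The dual of a code of dimension `m * t` and minimum rank at least `k - t + 1` has minimum rank
at least `t + 1`. -/
theorem lt_rank_of_mem_dual {D : Code F k m} {t : ℕ} (htk : t ≤ k)
    (hD : finrank F D = m * t) (hrank : ∀ M ∈ D, M ≠ 0 → k < M.rank + t)
    {N : Matrix (Fin k) (Fin m) F} (hN : N ∈ dual D) (hN0 : N ≠ 0) : t < N.rank := by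
  by_contra! hle
  have hker := rank_add_finrank_ker_rowLin N
  obtain ⟨g, hg⟩ := exists_injective_linearMap_of_le_finrank (K := F) (n := k - t)
    (V := LinearMap.ker (rowLin F k m N)) (by omega)
  -- The columns of `P` are independent and killed by `N.transpose`. The products `P * A` have rank
  -- at most `k - t` and are orthogonal to `N`; they form a complement of `D`.
  let P : Matrix (Fin k) (Fin (k - t)) F := LinearMap.toMatrix' (Submodule.subtype _ ∘ₗ g)
  have hP : ∀ v, P.mulVec v = (g v : Fin k → F) := by
    intro v
    simp [P, LinearMap.toMatrix'_mulVec]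
  have hNP : N.transpose * P = 0 := by
    apply Matrix.toLin'.injective
    refine LinearMap.ext fun v => ?_
    rw [Matrix.toLin'_apply, ← Matrix.mulVec_mulVec, hP, map_zero]
    exact (g v).2
  let Φ : Matrix (Fin (k - t)) (Fin m) F →ₗ[F] Matrix (Fin k) (Fin m) F :=
    mulLeftLinearMap (Fin m) F P
  have hΦ : ∀ M, Φ M = P * M := fun _ => rfl
  have hinj : Function.Injective Φ := by
    rw [← LinearMap.ker_eq_bot, LinearMap.ker_eq_bot']
    intro M hM
    apply Matrix.toLin'.injective
    refine LinearMap.ext fun v => ?_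
    apply hg
    apply Subtype.ext
    rw [← hP, Matrix.toLin'_apply, Matrix.mulVec_mulVec, ← hΦ, hM]
    simp
  have hdisj : Disjoint D (LinearMap.range Φ) := by
    rw [Submodule.disjoint_def]
    rintro _ hM ⟨A, rfl⟩
    by_contra h0
    have h1 := hrank _ hM h0
    have h2 : (Φ A).rank ≤ k - t := (Matrix.rank_mul_le_left P A).trans P.rank_le_width
    omega
  have hsup := sup_eq_top_of_disjoint hdisj (by
    rw [hD, LinearMap.finrank_range_of_inj hinj, finrank_matrix]
    simp only [Fintype.card_fin, finrank_self, mul_one]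
    obtain ⟨j, rfl⟩ := Nat.exists_eq_add_of_le htk
    rw [Nat.add_sub_cancel_left]
    exact le_of_eq (by ring))
  refine hN0 (eq_zero_of_mem_dual_of_mem_dual hsup hN ?_)
  rintro _ ⟨A, rfl⟩
  rw [traceProduct, hΦ, Matrix.mul_assoc, Matrix.trace_mul_comm, Matrix.mul_assoc, hNP,
    Matrix.mul_zero, Matrix.trace_zero]

/-- The code of transposed matrices. -/
def transposeCode (C : Code F k m) : Code F m k :=
  C.map (Matrix.transposeLinearEquiv (Fin k) (Fin m) F F).toLinearMap

theorem transpose_mem_transposeCode {C : Code F k m} {M : Matrix (Fin m) (Fin k) F} :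
    M ∈ transposeCode C ↔ M.transpose ∈ C := by
  constructor
  · rintro ⟨A, hA, rfl⟩
    simpa using hA
  · intro h
    exact ⟨_, h, by simp⟩

theorem finrank_transposeCode (C : Code F k m) : finrank F (transposeCode C) = finrank F C :=
  LinearEquiv.finrank_map_eq _ C

theorem maxrk_transposeCode (C : Code F k m) : maxrk (transposeCode C) = maxrk C := by
  apply le_antisymm
  · refine maxrk_le fun M hM => ?_
    rw [← M.rank_transpose]
    exact rank_le_maxrk (transpose_mem_transposeCode.1 hM)
  · refine maxrk_le fun M hM => ?_
    rw [← M.rank_transpose]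
    exact rank_le_maxrk (transpose_mem_transposeCode.2 (by simpa using hM))

theorem dual_transposeCode (C : Code F k m) : dual (transposeCode C) = transposeCode (dual C) := by
  ext N
  rw [transpose_mem_transposeCode]
  constructor
  · intro h M hM
    have := h M.transpose (transpose_mem_transposeCode.2 (by simpa using hM))
    rwa [← traceProduct_transpose, Matrix.transpose_transpose] at this
  · intro h M hM
    rw [← traceProduct_transpose]
    exact h _ (transpose_mem_transposeCode.1 hM)

end Duality

/-! ### The anticode bound and its equality case -/

section Anticode

variable {F : Type*} [Field F] [Finite F] {k m : ℕ}

/-- The anticode bound, for matrices with at least as many columns as rows. -/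
theorem finrank_le_mul_maxrk (hm : 0 < m) (hkm : k ≤ m) (C : Code F k m) :
    finrank F C ≤ m * maxrk C := by
  by_contra! hlt
  have hr : maxrk C < k := by
    have h1 := finrank_add_finrank_dual C
    by_contra! h
    have := Nat.mul_le_mul_left m h
    rw [mul_comm m k] at this
    omega
  -- Here any MRD code will do, so the prescribed matrix is just one of full rank `k`.
  obtain ⟨g, hg⟩ := exists_injective_linearMap_of_le_finrank (K := F) (n := k)
    (V := Fin m → F) (by simpa using hkm)
  have hrank := rank_add_finrank_ker_rowLin ((rowLin F k m).symm g)
  rw [LinearEquiv.apply_symm_apply, LinearMap.ker_eq_bot.2 hg, finrank_bot, add_zero] at hrank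
  obtain ⟨D, -, hD, hDr⟩ := exists_mrd_code_mem (t := k - maxrk C) hm hkm (Nat.sub_le _ _)
    ((rowLin F k m).symm g) (by omega)
  have hdisj : Disjoint C D := by
    rw [Submodule.disjoint_def]
    intro M hC hMD
    by_contra h0
    have h1 := hDr M hMD h0
    have h2 := rank_le_maxrk hC
    omega
  have h1 := Submodule.finrank_add_finrank_le_of_disjoint hdisj
  rw [finrank_matrix] at h1
  simp only [Fintype.card_fin, finrank_self, mul_one] at h1
  have h2 : m * maxrk C + m * (k - maxrk C) = k * m := by
    rw [← mul_add, Nat.add_sub_cancel' hr.le, mul_comm]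
  omega

theorem maxrk_add_maxrk_dual_le (hm : 0 < m) (hkm : k ≤ m) {C : Code F k m}
    (hC : finrank F C = m * maxrk C) : maxrk C + maxrk (dual C) ≤ k := by
  have hrk : maxrk C ≤ k := maxrk_le fun M _ => M.rank_le_height
  have hr : maxrk (dual C) ≤ k - maxrk C := by
    refine maxrk_le fun N hN => ?_
    by_contra! hlt
    have hN0 : N ≠ 0 := by
      rintro rfl
      simp at hlt
    obtain ⟨D, hND, hD, hDr⟩ := exists_mrd_code_mem hm hkm hrk N (by omega)
    have hdisj : Disjoint C (dual D) := by
      rw [Submodule.disjoint_def]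
      intro M hMC hMD
      by_contra h0
      have h1 := lt_rank_of_mem_dual hrk hD hDr hMD h0
      have h2 := rank_le_maxrk hMC
      omega
    have hsup := sup_eq_top_of_disjoint hdisj
      (by rw [hC, ← hD, finrank_add_finrank_dual])
    refine hN0 (eq_zero_of_mem_dual_of_mem_dual hsup hN ?_)
    intro M hM
    rw [traceProduct_comm]
    exact hM N hND
  omega

theorem maxrk_dual_bound_of_le (hm : 0 < m) (hkm : k ≤ m) (C : Code F k m) :
    k ≤ maxrk C + maxrk (dual C) ∧
      (maxrk C + maxrk (dual C) = k ↔ finrank F C = m * maxrk C) := by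
  have h1 := finrank_le_mul_maxrk hm hkm C
  have h2 := finrank_le_mul_maxrk hm hkm (dual C)
  have h3 := finrank_add_finrank_dual C
  have h4 : k ≤ maxrk C + maxrk (dual C) := by
    refine Nat.le_of_mul_le_mul_left ?_ hm
    rw [mul_add, mul_comm m k]
    omega
  refine ⟨h4, fun h => ?_, fun h => le_antisymm (maxrk_add_maxrk_dual_le hm hkm h) h4⟩
  have h5 : m * maxrk C + m * maxrk (dual C) = k * m := by rw [← mul_add, h, mul_comm]
  omega

end Anticode

end RankMetric

theorem proposition5p5 {F : Type*} [Field F] [Finite F] {k m : ℕ} (hk : 0 < k) (hm : 0 < m)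
    (C : RankMetric.Code F k m) :
    (RankMetric.maxrk C : ℤ) ≥ (min k m : ℕ) - (RankMetric.maxrk (RankMetric.dual C) : ℤ) ∧
      ((RankMetric.maxrk C : ℤ) = (min k m : ℕ) - (RankMetric.maxrk (RankMetric.dual C) : ℤ) ↔
        RankMetric.IsOptimalAnticode C) := by
  unfold RankMetric.IsOptimalAnticode
  rcases le_total k m with h | h
  · obtain ⟨h1, h2⟩ := RankMetric.maxrk_dual_bound_of_le hm h C
    rw [min_eq_left h, max_eq_right h, ← h2]
    omega
  · obtain ⟨h1, h2⟩ := RankMetric.maxrk_dual_bound_of_le hk h (RankMetric.transposeCode C)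
    rw [RankMetric.dual_transposeCode, RankMetric.maxrk_transposeCode,
      RankMetric.maxrk_transposeCode] at h1 h2
    rw [RankMetric.finrank_transposeCode] at h2
    rw [min_eq_right h, max_eq_left h, ← h2]
    omega
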